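/- Let $\ell>2$ be a prime number. Let $v$ be the extension of the $\ell$-adic valuation to an algebraic closure $\overline{\mathbb Q}_\ell$ of $\mathbb Q_\ell$, and put $\overline{\mathfrak m}=\{x\in\overline{\mathbb Q}_\ell : v(x)>0\}$. Let $\mathbf F=(F_1,F_2)$ be a $2$-dimensional formal group law over $\mathbb Z_\ell$, that is, a pair of power series $F_i(\mathbf X,\mathbf Y)\in\mathbb Z_\ell[[X_1,X_2,Y_1,Y_2]]$ with $F_i(\mathbf X,\mathbf Y)\equiv X_i+Y_i$ modulo terms of degree two and $F_i(\mathbf F(\mathbf X,\mathbf Y),\mathbf Z)=F_i(\mathbf X,\mathbf F(\mathbf Y,\mathbf Z))$ for $i=1,2$. Define $[1](\mathbf Z)=\mathbf Z$ and $[m+1](\mathbf Z)=\mathbf F(\mathbf Z,[m](\mathbf Z))$ for $m\ge1$, and let $\overline{[\ell]}_1,\overline{[\ell]}_2\in\mathbb F_\ell[[Z_1,Z_2]]$ be the two components of the multiplication-by-$\ell$ series of the reduction $\overline{\mathbf F}$ of $\mathbf F$ modulo $\ell$. Assume that: * $\mathbf F$ is symmetric: $F_2(X_2,X_1,Y_2,Y_1)=F_1(X_1,X_2,Y_1,Y_2)$;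 * $\mathbf F$ has height $4$: $\mathbb F_\ell[[Z_1,Z_2]]$ is a finite free module of rank $\ell^4$ over its subring $\mathbb F_\ell[[\,\overline{[\ell]}_1,\overline{[\ell]}_2\,]]$; * $\mathbf F$ has exponent $r=2$: the smallest $u\geq 1$ such that some variable $Z_j$ occurs raised to exactly the $u$-th power in a monomial with non-zero coefficient of $\overline{[\ell]}_1$ or $\overline{[\ell]}_2$ is $u=\ell^2$. Let $\mathbf F(\overline{\mathfrak m})$ be the set $\overline{\mathfrak m}\times\overline{\mathfrak m}$ with the addition law $(\mathbf x,\mathbf y)\mapsto(F_1(\mathbf x,\mathbf y),F_2(\mathbf x,\mathbf y))$, and let $V$ be the set of its $\ell$-torsion points, i.e. of the points whose $\ell$-fold sum is $(0,0)$ (an $\mathbb F_\ell$-vector space when $\mathbf F$ is commutative). Then the wild inertia group $I_{\mathrm w}\subset\mathrm{Gal}(\overline{\mathbb Q}_\ell/\mathbb Q_\ell)$, i.e. the largest pro-$\ell$ subgroup of the inertia group, acts trivially on $V$: for all $\sigma\in I_{\mathrm w}$ and all $(x_1,x_2)\in V$ one has $\sigma(x_1)=x_1$ and $\sigma(x_2)=x_2$.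 -/

import Mathlib

noncomputable section

open MvPowerSeries

/-- An `n`-dimensional formal group law over a commutative ring `R`: power series
`F 0, …, F (n-1)` in the variables `X i` (index `Sum.inl i`) and `Y i` (index `Sum.inr i`), with
`F i ≡ X i + Y i` modulo terms of degree two and `F (F (X, Y), Z) = F (X, F (Y, Z))`.
Commutativity is not part of the definition. -/
structure FormalGroupLaw (n : ℕ) (R : Type*) [CommRing R] where
  toSeries : Fin n → MvPowerSeries (Fin n ⊕ Fin n) R
  linear : ∀ i (d : Fin n ⊕ Fin n →₀ ℕ), d.degree < 2 →
    coeff d (toSeries i) =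
      coeff d (X (Sum.inl i) + X (Sum.inr i) : MvPowerSeries (Fin n ⊕ Fin n) R)
  /-- The three blocks of variables `X, Y, Z` are indexed by `Fin n ⊕ (Fin n ⊕ Fin n)`. -/
  assoc : ∀ i,
    (toSeries i).subst (S := R) (τ := Fin n ⊕ (Fin n ⊕ Fin n))
      (Sum.elim
        (fun j => (toSeries j).subst
          (Sum.elim (fun k => X (Sum.inl k)) (fun k => X (Sum.inr (Sum.inl k)))))
        (fun j => X (Sum.inr (Sum.inr j)))) =
    (toSeries i).subst
      (Sum.elim
        (fun j => X (Sum.inl j))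
        (fun j => (toSeries j).subst
          (Sum.elim (fun k => X (Sum.inr (Sum.inl k))) (fun k => X (Sum.inr (Sum.inr k))))))

namespace FormalGroupLaw

variable {n : ℕ} {R S : Type*} [CommRing R] [CommRing S]

theorem constantCoeff_toSeries (F : FormalGroupLaw n R) (i : Fin n) :
    constantCoeff (F.toSeries i) = 0 := by
  have h := F.linear i 0 (by simp)
  simpa using h

theorem hasSubst_elim {σ τ : Type*} [Finite σ] {a b : σ → MvPowerSeries τ R}
    (ha : ∀ j, constantCoeff (a j) = 0) (hb : ∀ j, constantCoeff (b j) = 0) :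
    HasSubst (Sum.elim a b) :=
  hasSubst_of_constantCoeff_zero (by rintro (j | j) <;> simp [ha, hb])

theorem map_subst_elim {σ τ : Type*} [Finite σ] {a b : σ → MvPowerSeries τ R}
    (ha : ∀ j, constantCoeff (a j) = 0) (hb : ∀ j, constantCoeff (b j) = 0) (φ : R →+* S)
    (f : MvPowerSeries (σ ⊕ σ) R) :
    MvPowerSeries.map φ (f.subst (Sum.elim a b)) =
      (MvPowerSeries.map φ f).subst
        (Sum.elim (fun j => MvPowerSeries.map φ (a j)) (fun j => MvPowerSeries.map φ (b j))) := by
  rw [map_subst (hasSubst_elim ha hb)]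
  congr 1
  funext s
  rcases s with s | s <;> rfl

theorem constantCoeff_subst_elim (F : FormalGroupLaw n R) {τ : Type*}
    {a b : Fin n → MvPowerSeries τ R}
    (ha : ∀ j, constantCoeff (a j) = 0) (hb : ∀ j, constantCoeff (b j) = 0) (i : Fin n) :
    constantCoeff ((F.toSeries i).subst (Sum.elim a b)) = 0 :=
  constantCoeff_subst_eq_zero (hasSubst_elim ha hb)
    (by rintro (j | j) <;> simp [ha, hb]) (F.constantCoeff_toSeries i)

/-- The formal group law obtained by applying a ring homomorphism to all coefficients. -/
def map (φ : R →+* S) (F : FormalGroupLaw n R) : FormalGroupLaw n S where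
  toSeries i := MvPowerSeries.map φ (F.toSeries i)
  linear i d hd := by
    have h := congrArg φ (F.linear i d hd)
    rw [← coeff_map, ← coeff_map] at h
    simpa using h
  assoc i := by
    have h := congrArg (MvPowerSeries.map φ) (F.assoc i)
    rw [map_subst_elim
        (fun j => F.constantCoeff_subst_elim (fun _ => constantCoeff_X _)
          (fun _ => constantCoeff_X _) j) (fun _ => constantCoeff_X _),
      map_subst_elim (fun _ => constantCoeff_X _)
        (fun j => F.constantCoeff_subst_elim (fun _ => constantCoeff_X _)
          (fun _ => constantCoeff_X _) j)] at h
    simp only [map_subst_elim (R := R) (fun _ => constantCoeff_X _) (fun _ => constantCoeff_X _),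
      map_X] at h
    exact h

/-- The multiplication-by-`m` power series: `[0](Z) = 0`, `[1](Z) = Z` and
`[m+1](Z) = F (Z, [m](Z))` for `m ≥ 1`. -/
def mulSeries (F : FormalGroupLaw n R) : ℕ → Fin n → MvPowerSeries (Fin n) R
  | 0 => fun _ => 0
  | 1 => fun i => X i
  | m + 2 => fun i => (F.toSeries i).subst (Sum.elim (fun j => X j) (F.mulSeries (m + 1)))

theorem constantCoeff_mulSeries (F : FormalGroupLaw n R) :
    ∀ (m : ℕ) (i : Fin n), constantCoeff (F.mulSeries m i) = 0
  | 0, _ => by simp [mulSeries]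
  | 1, _ => by simp [mulSeries]
  | m + 2, i => by
    rw [mulSeries]
    exact F.constantCoeff_subst_elim (fun _ => constantCoeff_X _)
      (F.constantCoeff_mulSeries (m + 1)) i

theorem hasSubst_mulSeries (F : FormalGroupLaw n R) (m : ℕ) : HasSubst (F.mulSeries m) :=
  hasSubst_of_constantCoeff_zero (F.constantCoeff_mulSeries m)

/-- The subring `k[[ [m]_1(Z), …, [m]_n(Z) ]]` of `k[[Z_1, …, Z_n]]`: all power series in the
components of the multiplication-by-`m` map. -/
def mulSubalgebra {k : Type*} [Field k] (F : FormalGroupLaw n k) (m : ℕ) :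
    Subalgebra k (MvPowerSeries (Fin n) k) :=
  (substAlgHom (R := k) (F.hasSubst_mulSeries m)).range

/-- A formal group law over a field `k` of characteristic `p` has (finite) height `h` if
`k[[Z_1, …, Z_n]]` is a finite free module of rank `p ^ h` over the subring
`k[[ [p]_1(Z), …, [p]_n(Z) ]]`. -/
def HasHeight (p : ℕ) {k : Type*} [Field k] (F : FormalGroupLaw n k) (h : ℕ) : Prop :=
  Module.Finite (F.mulSubalgebra p) (MvPowerSeries (Fin n) k) ∧
  Module.Free (F.mulSubalgebra p) (MvPowerSeries (Fin n) k) ∧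
  Module.finrank (F.mulSubalgebra p) (MvPowerSeries (Fin n) k) = p ^ h

/-- An `n`-tuple `f` of power series over a field of characteristic `p` has exponent `r` if
`p ^ r` is the smallest `u` such that in some `f i` some variable `Z j` occurs in a nonzero
monomial raised to the `u`-th power (with `u > 0`, as the variable occurs). -/
def HasExponent (p : ℕ) {k : Type*} [Field k] (f : Fin n → MvPowerSeries (Fin n) k) (r : ℕ) :
    Prop :=
  IsLeast {u : ℕ | 0 < u ∧ ∃ (i j : Fin n) (d : Fin n →₀ ℕ), coeff d (f i) ≠ 0 ∧ d j = u}
    (p ^ r)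

/-- A `2`-dimensional formal group law is symmetric if
`F_2 (X_2, X_1, Y_2, Y_1) = F_1 (X_1, X_2, Y_1, Y_2)`. -/
def IsSymmetric (F : FormalGroupLaw 2 R) : Prop :=
  (F.toSeries 1).subst
      (Sum.elim (fun j : Fin 2 => (X (Sum.inl (Equiv.swap 0 1 j)) : MvPowerSeries (Fin 2 ⊕ Fin 2) R))
        (fun j : Fin 2 => X (Sum.inr (Equiv.swap 0 1 j)))) =
    F.toSeries 0

/-- The reduction modulo `p` of a formal group law over `ℤ_[p]`. -/
def reduction {p : ℕ} [Fact p.Prime] (F : FormalGroupLaw n ℤ_[p]) : FormalGroupLaw n (ZMod p) :=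
  F.map PadicInt.toZMod

end FormalGroupLaw

section Points

variable (p : ℕ) [Fact p.Prime]

/-- The set of elements of positive valuation in the algebraic closure of `ℚ_[p]`. Here `‖x‖` is
the unique extension of the `p`-adic norm, so that `‖x‖ < 1` means `v x > 0`. -/
def MBar : Type := {x : PadicAlgCl p // ‖x‖ < 1}

variable {p}

section Eval

variable {σ : Type*} [Fintype σ]

/-- The value at `x` of a power series with coefficients in `ℤ_[p]`. -/
def padicEval (f : MvPowerSeries σ ℤ_[p]) (x : σ → PadicAlgCl p) : PadicAlgCl p :=
  ∑' d : σ →₀ ℕ, algebraMap ℚ_[p] (PadicAlgCl p) (coeff d f : ℤ_[p]) * ∏ s, x s ^ d s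

theorem exists_norm_bound {x : σ → PadicAlgCl p} (hx : ∀ s, ‖x s‖ < 1) :
    ∃ r : ℝ, 0 ≤ r ∧ r < 1 ∧ ∀ s, ‖x s‖ ≤ r := by
  refine ⟨((Finset.univ.sup fun s => ‖x s‖₊ : NNReal) : ℝ), NNReal.coe_nonneg _, ?_, fun s => ?_⟩
  · have : (Finset.univ.sup fun s => ‖x s‖₊) < 1 := by
      rw [Finset.sup_lt_iff (by simp)]
      exact fun s _ => hx s
    exact_mod_cast this
  · exact_mod_cast Finset.le_sup (f := fun s => ‖x s‖₊) (Finset.mem_univ s)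

theorem norm_padicTerm_le {x : σ → PadicAlgCl p} {r : ℝ} (hx : ∀ s, ‖x s‖ ≤ r)
    (c : ℤ_[p]) (d : σ →₀ ℕ) :
    ‖algebraMap ℚ_[p] (PadicAlgCl p) c * ∏ s, x s ^ d s‖ ≤ r ^ d.degree := by
  have h1 : ‖algebraMap ℚ_[p] (PadicAlgCl p) (c : ℚ_[p])‖ ≤ 1 := by
    rw [PadicAlgCl.norm_extends]
    exact c.2
  have h2 : ‖∏ s, x s ^ d s‖ ≤ r ^ d.degree := by
    rw [norm_prod, Finsupp.degree_eq_sum, ← Finset.prod_pow_eq_pow_sum]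
    refine Finset.prod_le_prod (fun s _ => norm_nonneg _) (fun s _ => ?_)
    rw [norm_pow]
    exact pow_le_pow_left₀ (norm_nonneg _) (hx s) _
  rw [norm_mul]
  calc _ ≤ 1 * r ^ d.degree := by gcongr
    _ = _ := one_mul _

/-- The series defining `padicEval` converges, in the (incomplete) field `PadicAlgCl p`, at every
point with coordinates of positive valuation. -/
theorem summable_padicEval (f : MvPowerSeries σ ℤ_[p]) {x : σ → PadicAlgCl p}
    (hx : ∀ s, ‖x s‖ < 1) :
    Summable fun d : σ →₀ ℕ =>
      algebraMap ℚ_[p] (PadicAlgCl p) (coeff d f : ℤ_[p]) * ∏ s, x s ^ d s := by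
  obtain ⟨r, hr0, hr1, hr⟩ := exists_norm_bound hx
  let E : IntermediateField ℚ_[p] (PadicAlgCl p) := IntermediateField.adjoin ℚ_[p] (Set.range x)
  have hE : FiniteDimensional ℚ_[p] E :=
    IntermediateField.finiteDimensional_adjoin
      (fun y _ => (Algebra.IsAlgebraic.isAlgebraic y).isIntegral)
  let M : Submodule ℚ_[p] (PadicAlgCl p) := Subalgebra.toSubmodule E.toSubalgebra
  have hM : FiniteDimensional ℚ_[p] M := hE
  have : CompleteSpace M := FiniteDimensional.complete ℚ_[p] M
  have hmem : ∀ d : σ →₀ ℕ,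
      algebraMap ℚ_[p] (PadicAlgCl p) (coeff d f : ℤ_[p]) * ∏ s, x s ^ d s ∈ M := fun d =>
    E.mul_mem (E.algebraMap_mem _) (prod_mem fun s _ =>
      pow_mem (IntermediateField.subset_adjoin _ _ (Set.mem_range_self s)) _)
  have hlim : Filter.Tendsto (fun d : σ →₀ ℕ => (⟨_, hmem d⟩ : M)) Filter.cofinite (nhds 0) := by
    rw [tendsto_zero_iff_norm_tendsto_zero]
    refine squeeze_zero (g := fun d : σ →₀ ℕ => r ^ d.degree) (fun d => norm_nonneg _)
      (fun d => norm_padicTerm_le hr _ d) ?_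
    refine (tendsto_pow_atTop_nhds_zero_of_lt_one hr0 hr1).comp ?_
    rw [← Nat.cofinite_eq_atTop]
    refine Filter.Tendsto.cofinite_of_finite_preimage_singleton fun N => ?_
    exact (Finsupp.finite_of_degree_le N).subset fun d hd => le_of_eq hd
  have hs := NonarchimedeanAddGroup.summable_of_tendsto_cofinite_zero hlim
  exact hs.map M.subtype continuous_subtype_val

theorem norm_padicEval_lt_one (f : MvPowerSeries σ ℤ_[p]) (hf : constantCoeff f = 0)
    {x : σ → PadicAlgCl p} (hx : ∀ s, ‖x s‖ < 1) : ‖padicEval f x‖ < 1 := by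
  obtain ⟨r, hr0, hr1, hr⟩ := exists_norm_bound hx
  refine lt_of_le_of_lt ?_ hr1
  refine le_of_tendsto (summable_padicEval f hx).hasSum.norm (Filter.Eventually.of_forall fun t => ?_)
  refine IsUltrametricDist.norm_sum_le_of_forall_le_of_nonneg hr0 fun d _ => ?_
  by_cases hd : d = 0
  · subst hd
    simpa [hf] using hr0
  · refine (norm_padicTerm_le hr _ d).trans ?_
    exact pow_le_of_le_one hr0 hr1.le (fun h => hd ((Finsupp.degree_eq_zero_iff d).1 h))

end Eval

namespace FormalGroupLaw

variable {n : ℕ}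

/-- The addition law `(x, y) ↦ (F_1 (x, y), …, F_n (x, y))` on `n`-tuples of elements of
positive valuation. -/
def pointAdd (F : FormalGroupLaw n ℤ_[p]) (P Q : Fin n → MBar p) : Fin n → MBar p := fun i =>
  ⟨padicEval (F.toSeries i) (Sum.elim (fun j => (P j).1) (fun j => (Q j).1)),
    norm_padicEval_lt_one _ (F.constantCoeff_toSeries i)
      (by rintro (j | j); exacts [(P j).2, (Q j).2])⟩

/-- The neutral element `(0, …, 0)`. -/
def pointZero : Fin n → MBar p := fun _ => ⟨0, by simp⟩

/-- The `m`-fold sum `P ⊕ (P ⊕ (⋯ ⊕ P))`. -/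
def pointMul (F : FormalGroupLaw n ℤ_[p]) (P : Fin n → MBar p) : ℕ → (Fin n → MBar p)
  | 0 => pointZero
  | 1 => P
  | m + 2 => F.pointAdd P (F.pointMul P (m + 1))

/-- The set of `m`-torsion points of the group of points of `F` with coordinates of positive
valuation in the algebraic closure of `ℚ_[p]`. -/
def torsionPoints (F : FormalGroupLaw n ℤ_[p]) (m : ℕ) : Set (Fin n → MBar p) :=
  {P | F.pointMul P m = pointZero}

end FormalGroupLaw

end Points

section Inertia

variable (p : ℕ) [Fact p.Prime]

/-- The inertia subgroup of the absolute Galois group of `ℚ_[p]`. -/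
def padicInertia : Subgroup Gal(PadicAlgCl p/ℚ_[p]) :=
  ((PadicAlgCl.valued p).v.valuationSubring.inertiaSubgroup ℚ_[p]).map (Subgroup.subtype _)

/-- A subgroup of the absolute Galois group of `ℚ_[p]` is pro-`p` if its image in the Galois group
of every finite Galois extension of `ℚ_[p]` is a `p`-group. -/
def IsProPSubgroup (H : Subgroup Gal(PadicAlgCl p/ℚ_[p])) : Prop :=
  ∀ (E : IntermediateField ℚ_[p] (PadicAlgCl p)) [FiniteDimensional ℚ_[p] E] [IsGalois ℚ_[p] E],
    IsPGroup p (H.map (AlgEquiv.restrictNormalHom (F := ℚ_[p]) (K₁ := PadicAlgCl p) E))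

/-- The wild inertia group: the largest pro-`p` subgroup of the inertia group. -/
def padicWildInertia : Subgroup Gal(PadicAlgCl p/ℚ_[p]) :=
  sSup {H | H ≤ padicInertia p ∧ IsProPSubgroup p H}

end Inertia

end

noncomputable section

open MvPowerSeries

/-! Torsion points are the zeros of `f = [ℓ]` in the open unit polydisc. Put `q = ℓ ^ 2`. By the
exponent hypothesis every monomial of `f` modulo `ℓ` is divisible by some `Z_j ^ q`, and the height
makes the rank equal to `q ^ 2`, the dimension of the quotient of `𝔽_ℓ[[Z]]` by the ideal `(Z_j ^
q)`. Hence the reduction of `f` generates this whole ideal, and the matrix of coefficients of the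
`Z_j ^ q` is invertible modulo `ℓ` (`exists_mul_coeff_single_eq_one`, `isFrobeniusLike_mulSeries`).

So `f` behaves like `ℓ Z + M Z ^ q` with `M` invertible. Let `π ^ (q - 1) = ℓ`. Comparing the sizes
of the terms, every zero has norm at most `‖π‖` (`norm_pow_le_of_padicEval_eq_zero`), and two zeros
at distance less than `‖π‖` coincide (`eq_of_norm_sub_lt`).

Wild inertia fixes `π`, since `q - 1` is prime to `ℓ`, and inertia acts trivially on residues. As `x
/ π` is integral, `g x / π` and `x / π` have the same residue, so `g x` is a zero at distance less
than `‖π‖` from `x`. Hence `g x = x`. -/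

theorem le_order_subst_of_constantCoeff_eq_zero {R σ τ : Type*} [CommRing R] [Finite τ]
    {a : τ → MvPowerSeries σ R} (ha : ∀ t, constantCoeff (a t) = 0) (f : MvPowerSeries τ R) :
    f.order ≤ (f.subst a).order := by
  refine le_trans ?_ (le_order_subst (hasSubst_of_constantCoeff_zero ha) f)
  refine le_mul_of_one_le_left' (le_iInf fun t => ?_)
  exact one_le_order_iff_constCoeff_eq_zero.2 (ha t)

/-! ### Evaluation on the open polydisc: ring homomorphism, substitution, Galois action. -/

section Evaluation

variable {p : ℕ} [Fact p.Prime]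

/-- The structure map `ℤ_[p] → PadicAlgCl p`. -/
def padicIntToAlgCl (p : ℕ) [Fact p.Prime] : ℤ_[p] →+* PadicAlgCl p :=
  (algebraMap ℚ_[p] (PadicAlgCl p)).comp PadicInt.Coe.ringHom

theorem norm_padicIntToAlgCl (c : ℤ_[p]) : ‖padicIntToAlgCl p c‖ = ‖c‖ :=
  PadicAlgCl.norm_extends p c

variable {σ τ : Type*} [Fintype σ] [Fintype τ] {x : σ → PadicAlgCl p}

theorem padicEval_def (f : MvPowerSeries σ ℤ_[p]) (x : σ → PadicAlgCl p) :
    padicEval f x = ∑' d : σ →₀ ℕ, padicIntToAlgCl p (coeff d f) * ∏ s, x s ^ d s := rfl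

theorem summable_padicIntToAlgCl (f : MvPowerSeries σ ℤ_[p]) (hx : ∀ s, ‖x s‖ < 1) :
    Summable fun d : σ →₀ ℕ => padicIntToAlgCl p (coeff d f) * ∏ s, x s ^ d s :=
  summable_padicEval f hx

theorem padicEval_add (f g : MvPowerSeries σ ℤ_[p]) (hx : ∀ s, ‖x s‖ < 1) :
    padicEval (f + g) x = padicEval f x + padicEval g x := by
  simp only [padicEval_def]
  rw [← (summable_padicIntToAlgCl f hx).tsum_add (summable_padicIntToAlgCl g hx)]
  simp [add_mul]

theorem padicEval_coe (P : MvPolynomial σ ℤ_[p]) (x : σ → PadicAlgCl p) :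
    padicEval (P : MvPowerSeries σ ℤ_[p]) x = P.eval₂ (padicIntToAlgCl p) x := by
  rw [padicEval_def, MvPolynomial.eval₂_eq', tsum_eq_sum (s := P.support)]
  · simp
  · intro d hd
    simp [MvPolynomial.notMem_support_iff.1 hd]

theorem norm_padicEval_le {f : MvPowerSeries σ ℤ_[p]} {C : ℝ} (hC : 0 ≤ C)
    (h : ∀ d : σ →₀ ℕ, ‖padicIntToAlgCl p (coeff d f) * ∏ s, x s ^ d s‖ ≤ C) :
    ‖padicEval f x‖ ≤ C :=
  IsUltrametricDist.norm_tsum_le_of_forall_le_of_nonneg hC h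

theorem norm_padicEval_le_pow {f : MvPowerSeries σ ℤ_[p]} {r : ℝ} (hr0 : 0 ≤ r) (hr1 : r ≤ 1)
    (hx : ∀ s, ‖x s‖ ≤ r) {N : ℕ} (hf : ∀ d : σ →₀ ℕ, d.degree < N → coeff d f = 0) :
    ‖padicEval f x‖ ≤ r ^ N := by
  refine norm_padicEval_le (by positivity) fun d => ?_
  rcases lt_or_ge d.degree N with hd | hd
  · rw [hf d hd]
    simpa using pow_nonneg hr0 N
  · exact (norm_padicTerm_le hx _ d).trans (pow_le_pow_of_le_one hr0 hr1 hd)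

/-- Identities between values of series are proved by truncating in degree `N`, using the polynomial
identity, and bounding the error by `r ^ N`. -/
theorem eq_of_forall_norm_sub_le_pow {a b : PadicAlgCl p} {r : ℝ} (hr0 : 0 ≤ r) (hr1 : r < 1)
    (h : ∀ N : ℕ, ‖a - b‖ ≤ r ^ N) : a = b := by
  rw [← sub_eq_zero, ← norm_le_zero_iff]
  exact ge_of_tendsto' (tendsto_pow_atTop_nhds_zero_of_lt_one hr0 hr1) h

theorem padicEval_sub (f g : MvPowerSeries σ ℤ_[p]) (hx : ∀ s, ‖x s‖ < 1) :
    padicEval (f - g) x = padicEval f x - padicEval g x := by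
  rw [eq_sub_iff_add_eq, ← padicEval_add _ _ hx, sub_add_cancel]

theorem norm_padicEval_sub_truncTotal_le (f : MvPowerSeries σ ℤ_[p]) {r : ℝ} (hr0 : 0 ≤ r)
    (hr1 : r < 1) (hx : ∀ s, ‖x s‖ ≤ r) (N : ℕ) :
    ‖padicEval f x - padicEval (truncTotal N f : MvPowerSeries σ ℤ_[p]) x‖ ≤ r ^ N := by
  rw [← padicEval_sub _ _ fun s => (hx s).trans_lt hr1]
  refine norm_padicEval_le_pow hr0 hr1.le hx fun d hd => ?_
  rw [map_sub, MvPolynomial.coeff_coe, coeff_truncTotal _ hd, sub_self]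

theorem padicEval_mul (f g : MvPowerSeries σ ℤ_[p]) (hx : ∀ s, ‖x s‖ < 1) :
    padicEval (f * g) x = padicEval f x * padicEval g x := by
  obtain ⟨r, hr0, hr1, hr⟩ := exists_norm_bound hx
  refine eq_of_forall_norm_sub_le_pow hr0 hr1 fun N => ?_
  set f' : MvPowerSeries σ ℤ_[p] := ↑(truncTotal N f) with hf'
  set g' : MvPowerSeries σ ℤ_[p] := ↑(truncTotal N g) with hg'
  have hmul : padicEval (f' * g') x = padicEval f' x * padicEval g' x := by
    rw [hf', hg', ← MvPolynomial.coe_mul]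
    simp only [padicEval_coe, MvPolynomial.eval₂_mul]
  have hle : ∀ h : MvPowerSeries σ ℤ_[p], ‖padicEval h x‖ ≤ 1 := fun h => by
    simpa using norm_padicEval_le_pow (N := 0) (f := h) hr0 hr1.le hr (by simp)
  have h1 : ‖padicEval (f * g) x - padicEval (f' * g') x‖ ≤ r ^ N := by
    rw [← padicEval_sub _ _ hx]
    refine norm_padicEval_le_pow hr0 hr1.le hr fun d hd => ?_
    rw [map_sub, hf', hg', ← MvPolynomial.coe_mul, MvPolynomial.coeff_coe,
      coeff_truncTotal_mul_truncTotal_eq_coeff_mul _ _ hd, sub_self]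
  have h2 : ‖(padicEval f' x - padicEval f x) * padicEval g' x‖ ≤ r ^ N := by
    rw [norm_mul, norm_sub_rev]
    exact (mul_le_of_le_one_right (norm_nonneg _) (hle _)).trans
      (norm_padicEval_sub_truncTotal_le f hr0 hr1 hr N)
  have h3 : ‖padicEval f x * (padicEval g' x - padicEval g x)‖ ≤ r ^ N := by
    rw [norm_mul, norm_sub_rev, mul_comm]
    exact (mul_le_of_le_one_right (norm_nonneg _) (hle _)).trans
      (norm_padicEval_sub_truncTotal_le g hr0 hr1 hr N)
  have key : padicEval (f * g) x - padicEval f x * padicEval g x =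
      (padicEval (f * g) x - padicEval (f' * g') x) +
        ((padicEval f' x - padicEval f x) * padicEval g' x +
          padicEval f x * (padicEval g' x - padicEval g x)) := by
    rw [hmul]; ring
  rw [key]
  exact (IsUltrametricDist.norm_add_le_max _ _).trans
    (max_le h1 ((IsUltrametricDist.norm_add_le_max _ _).trans (max_le h2 h3)))

/-- Evaluation of power series at a point with coordinates of positive valuation. -/
def padicEvalHom (x : σ → PadicAlgCl p) (hx : ∀ s, ‖x s‖ < 1) :
    MvPowerSeries σ ℤ_[p] →+* PadicAlgCl p where
  toFun f := padicEval f x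
  map_zero' := by simp [padicEval_def]
  map_one' := by
    have := padicEval_coe (1 : MvPolynomial σ ℤ_[p]) x
    simpa using this
  map_add' f g := padicEval_add f g hx
  map_mul' f g := padicEval_mul f g hx

theorem padicEval_C (c : ℤ_[p]) : padicEval (C c : MvPowerSeries σ ℤ_[p]) x =
    padicIntToAlgCl p c := by
  have := padicEval_coe (MvPolynomial.C c) x
  simpa using this

theorem padicEval_X (s : σ) : padicEval (X s : MvPowerSeries σ ℤ_[p]) x = x s := by
  have := padicEval_coe (MvPolynomial.X s) x
  simpa using this

theorem padicEval_subst {a : τ → MvPowerSeries σ ℤ_[p]} (ha : ∀ t, constantCoeff (a t) = 0)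
    (f : MvPowerSeries τ ℤ_[p]) (hx : ∀ s, ‖x s‖ < 1) :
    padicEval (f.subst a) x = padicEval f fun t => padicEval (a t) x := by
  obtain ⟨r, hr0, hr1, hr⟩ := exists_norm_bound hx
  have hs : HasSubst a := hasSubst_of_constantCoeff_zero ha
  have hy : ∀ t, ‖padicEval (a t) x‖ ≤ r := fun t => by
    have h := norm_padicEval_le_pow (N := 1) (f := a t) hr0 hr1.le hr fun d hd => by
      rw [Nat.lt_one_iff, Finsupp.degree_eq_zero_iff] at hd
      rw [hd, coeff_zero_eq_constantCoeff_apply, ha]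
    simpa using h
  refine eq_of_forall_norm_sub_le_pow hr0 hr1 fun N => ?_
  have hpoly : padicEval ((truncTotal N f : MvPowerSeries τ ℤ_[p]).subst a) x =
      padicEval (truncTotal N f : MvPowerSeries τ ℤ_[p]) fun t => padicEval (a t) x := by
    rw [subst_coe, padicEval_coe]
    change padicEvalHom x hx _ = _
    rw [MvPolynomial.aeval_def, MvPolynomial.hom_eval₂]
    congr 1
    ext c
    exact padicEval_C c
  have h1 : ‖padicEval (f.subst a) x -
      padicEval ((truncTotal N f : MvPowerSeries τ ℤ_[p]).subst a) x‖ ≤ r ^ N := by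
    rw [← padicEval_sub _ _ hx, ← subst_sub hs]
    refine norm_padicEval_le_pow hr0 hr1.le hr fun d hd => ?_
    refine coeff_of_lt_order (lt_of_lt_of_le (Nat.cast_lt.2 hd) ?_)
    -- The tail `f - truncTotal N f` has order at least `N`, and substituting series without
    -- constant term does not lower the order.
    refine le_trans (nat_le_order fun e he => ?_) (le_order_subst_of_constantCoeff_eq_zero ha _)
    rw [map_sub, MvPolynomial.coeff_coe, coeff_truncTotal _ he, sub_self]
  have h2 := norm_padicEval_sub_truncTotal_le f hr0 hr1 hy N
  rw [← hpoly, norm_sub_rev] at h2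
  have := (IsUltrametricDist.norm_add_le_max _ _).trans (max_le h1 h2)
  simpa using this

theorem norm_galois (g : Gal(PadicAlgCl p/ℚ_[p])) (y : PadicAlgCl p) : ‖g y‖ = ‖y‖ :=
  (spectralNorm_eq_of_equiv g y).symm

/-- The norm is the spectral norm, hence Galois invariant; so `g` is continuous and passes through
the sum, fixing the coefficients. -/
theorem galois_padicEval (g : Gal(PadicAlgCl p/ℚ_[p])) (f : MvPowerSeries σ ℤ_[p])
    (hx : ∀ s, ‖x s‖ < 1) : g (padicEval f x) = padicEval f fun s => g (x s) := by
  have hg : Continuous g :=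
    (AddMonoidHomClass.isometry_of_norm g (norm_galois g)).continuous
  rw [padicEval_def, (summable_padicIntToAlgCl f hx).map_tsum g hg, padicEval_def]
  refine tsum_congr fun d => ?_
  rw [map_mul, map_prod]
  congr 1
  · exact g.commutes _
  · simp

end Evaluation

/-! ### Torsion points as zeros of the multiplication series. -/

namespace FormalGroupLaw

variable {p : ℕ} [Fact p.Prime] {n : ℕ}

theorem pointMul_eq_padicEval (F : FormalGroupLaw n ℤ_[p]) (P : Fin n → MBar p) :
    ∀ (m : ℕ) (i : Fin n),
      (F.pointMul P m i).1 = padicEval (F.mulSeries m i) fun j => (P j).1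
  | 0, i => by simp [pointMul, mulSeries, pointZero, padicEval]
  | 1, i => by simp [pointMul, mulSeries, padicEval_X]
  | m + 2, i => by
    have hs : ∀ s, constantCoeff (Sum.elim (fun j => X j) (F.mulSeries (m + 1)) s :
        MvPowerSeries (Fin n) ℤ_[p]) = 0 := by
      rintro (j | j) <;> simp [F.constantCoeff_mulSeries]
    rw [mulSeries, padicEval_subst hs _ fun j => (P j).2]
    change padicEval _ _ = _
    congr 1
    funext s
    rcases s with j | j
    · simp [padicEval_X]
    · exact F.pointMul_eq_padicEval P (m + 1) j

theorem padicEval_mulSeries_eq_zero {F : FormalGroupLaw n ℤ_[p]} {m : ℕ} {P : Fin n → MBar p}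
    (hP : P ∈ F.torsionPoints m) (i : Fin n) :
    padicEval (F.mulSeries m i) (fun j => (P j).1) = 0 := by
  rw [← pointMul_eq_padicEval, show F.pointMul P m = pointZero from hP]
  rfl

end FormalGroupLaw

/-! ### Linear part and reduction of the multiplication series. -/

namespace FormalGroupLaw

variable {R : Type*} [CommRing R] {n : ℕ}

theorem two_le_order_sub_linear (F : FormalGroupLaw n R) (i : Fin n) :
    2 ≤ (F.toSeries i - (X (Sum.inl i) + X (Sum.inr i))).order :=
  nat_le_order fun d hd => by rw [map_sub, F.linear i d hd, sub_self]

/-- The terms of `F` beyond `X + Y` have order at least two, and still do after substitution, so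
they do not affect linear coefficients. -/
theorem coeff_single_subst_elim (F : FormalGroupLaw n R) {τ : Type*}
    {a b : Fin n → MvPowerSeries τ R} (ha : ∀ j, constantCoeff (a j) = 0)
    (hb : ∀ j, constantCoeff (b j) = 0) (i : Fin n) (t : τ) :
    coeff (Finsupp.single t 1) ((F.toSeries i).subst (Sum.elim a b)) =
      coeff (Finsupp.single t 1) (a i) + coeff (Finsupp.single t 1) (b i) := by
  have hs := hasSubst_elim ha hb
  have h := (F.two_le_order_sub_linear i).trans
    (le_order_subst_of_constantCoeff_eq_zero (a := Sum.elim a b)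
      (by rintro (j | j) <;> simp [ha, hb]) _)
  have h0 := coeff_of_lt_order (d := Finsupp.single t 1) (lt_of_lt_of_le (by simp) h)
  rw [subst_sub hs, subst_add hs, subst_X hs, subst_X hs, map_sub, sub_eq_zero] at h0
  simpa using h0

theorem coeff_single_mulSeries (F : FormalGroupLaw n R) (i j : Fin n) :
    ∀ m : ℕ, coeff (Finsupp.single j 1) (F.mulSeries m i) = if i = j then (m : R) else 0
  | 0 => by simp [mulSeries]
  | 1 => by
    simp only [mulSeries, coeff_X, Nat.cast_one, Finsupp.single_left_inj one_ne_zero]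
    simp [eq_comm]
  | m + 2 => by
    rw [mulSeries, F.coeff_single_subst_elim (fun _ => constantCoeff_X _)
      (F.constantCoeff_mulSeries (m + 1)), coeff_single_mulSeries F i j (m + 1), coeff_X]
    simp only [Finsupp.single_left_inj one_ne_zero]
    rcases eq_or_ne i j with h | h
    · subst h
      simp only [if_true]
      push_cast
      ring
    · simp [h, h.symm]

theorem map_mulSeries {S : Type*} [CommRing S] (φ : R →+* S) (F : FormalGroupLaw n R) :
    ∀ (m : ℕ) (i : Fin n), (F.map φ).mulSeries m i = MvPowerSeries.map φ (F.mulSeries m i)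
  | 0, i => by simp [mulSeries]
  | 1, i => by simp [mulSeries]
  | m + 2, i => by
    rw [mulSeries, mulSeries, map_subst_elim (fun _ => constantCoeff_X _)
      (F.constantCoeff_mulSeries (m + 1))]
    simp only [map_X, ← map_mulSeries φ F (m + 1)]
    rfl

end FormalGroupLaw

/-! ### The ideal generated by the reduced series. -/

section Intersection

variable {k : Type*} [Field k] {n : ℕ}

theorem mem_span_X_of_constantCoeff_eq_zero {R σ : Type*} [CommRing R] [Fintype σ]
    {f : MvPowerSeries σ R} (hf : constantCoeff f = 0) :
    f ∈ Ideal.span (Set.range (X : σ → MvPowerSeries σ R)) := by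
  classical
  -- For each nonconstant monomial one variable dividing it is selected; grouping the terms of `f`
  -- by this choice writes `f` as a sum of multiples of the variables.
  have hex : ∀ d : σ →₀ ℕ, ∃ s : Option σ, (∀ t ∈ s, d t ≠ 0) ∧ (s = none → d = 0) := by
    intro d
    by_cases hd : d = 0
    · exact ⟨none, by simp, fun _ => hd⟩
    · obtain ⟨t, ht⟩ := Finsupp.ne_iff.1 hd
      exact ⟨some t, by simpa using ht, by simp⟩
  choose s hs hs0 using hex
  let g : σ → MvPowerSeries σ R := fun t d => if s d = some t then coeff d f else 0
  have hg : ∀ t d, coeff d (g t) = if s d = some t then coeff d f else 0 := fun _ _ => rfl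
  have hfg : f = ∑ t, g t := by
    ext d
    simp only [map_sum, hg]
    rcases h : s d with _ | t
    · rw [hs0 d h, coeff_zero_eq_constantCoeff_apply, hf]
      simp
    · simp
  rw [hfg]
  refine Ideal.sum_mem _ fun t _ => ?_
  have hdvd : X t ∣ g t := X_dvd_iff.2 fun d hd => by
    rw [hg, if_neg]
    exact fun h => hs d t h hd
  exact Ideal.mem_of_dvd _ hdvd (Ideal.subset_span ⟨t, rfl⟩)

/-- Modulo the ideal `(f)` the ring `k[[f]]` collapses to the constants, so a basis over `k[[f]]`
gives generators of the quotient over `k`. -/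
theorem subst_sub_C_mem_span {σ τ : Type*} [Fintype τ] {f : τ → MvPowerSeries σ k}
    (hf : ∀ i, constantCoeff (f i) = 0) (g : MvPowerSeries τ k) :
    g.subst f - C (constantCoeff g) ∈ Ideal.span (Set.range f) := by
  have hs : HasSubst f := hasSubst_of_constantCoeff_zero hf
  have hg : g - C (constantCoeff g) ∈ Ideal.span (Set.range (X : τ → MvPowerSeries τ k)) :=
    mem_span_X_of_constantCoeff_eq_zero (by simp)
  have h := Ideal.mem_map_of_mem (substAlgHom (R := k) hs) hg
  have hX : ⇑(substAlgHom (R := k) hs) ∘ (X : τ → MvPowerSeries τ k) = f :=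
    funext fun i => substAlgHom_X hs i
  rwa [Ideal.map_span, ← Set.range_comp, hX, map_sub, substAlgHom_apply, substAlgHom_apply,
    subst_C] at h

/-- The coefficients at the monomials in which every exponent is smaller than `q`. -/
def lowCoeff (k : Type*) [Field k] (n q : ℕ) :
    MvPowerSeries (Fin n) k →ₗ[k] ((Fin n → Fin q) → k) :=
  LinearMap.pi fun e => coeff (Finsupp.equivFunOnFinite.symm fun i => (e i : ℕ))

theorem lowCoeff_surjective (q : ℕ) : Function.Surjective (lowCoeff k n q) := by
  intro v
  refine ⟨fun d => if h : ∀ i, d i < q then v fun i => ⟨d i, h i⟩ else 0, ?_⟩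
  funext e
  change (if h : ∀ i, _ then _ else _) = _
  simp

theorem lowCoeff_eq_zero_iff {q : ℕ} {f : MvPowerSeries (Fin n) k} :
    lowCoeff k n q f = 0 ↔ ∀ d : Fin n →₀ ℕ, (∀ i, d i < q) → coeff d f = 0 := by
  constructor
  · intro h d hd
    have := congrFun h fun i => ⟨d i, hd i⟩
    change coeff _ f = 0 at this
    convert this
    ext i
    simp
  · intro h
    funext e
    exact h _ fun i => by simp

/-- A divisor of a monomial with all exponents below `q` is again of this kind, so the kernel of
`lowCoeff` is an ideal. -/
theorem lowCoeff_eq_zero_of_mem_span {q : ℕ} {f : Fin n → MvPowerSeries (Fin n) k}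
    (hf : ∀ i, lowCoeff k n q (f i) = 0) {g : MvPowerSeries (Fin n) k}
    (hg : g ∈ Ideal.span (Set.range f)) : lowCoeff k n q g = 0 := by
  classical
  induction hg using Submodule.span_induction with
  | mem _ h => obtain ⟨i, rfl⟩ := h; exact hf i
  | zero => simp
  | add _ _ _ _ h1 h2 => rw [map_add, h1, h2, add_zero]
  | smul a x _ h =>
    rw [lowCoeff_eq_zero_iff] at h ⊢
    intro d hd
    rw [smul_eq_mul, coeff_mul]
    refine Finset.sum_eq_zero fun c hc => ?_
    rw [Finset.HasAntidiagonal.mem_antidiagonal] at hc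
    rw [h c.2 fun i => lt_of_le_of_lt ?_ (hd i), mul_zero]
    rw [← hc]
    simp

/-- If `k[[Z]]` is free of rank at most `q ^ n` over `k[[f]]` and no `f i` contains a monomial
all of whose exponents are smaller than `q`, then the `f i` generate every power series of this
kind. -/
theorem mem_span_of_lowCoeff_eq_zero {q : ℕ} {f : Fin n → MvPowerSeries (Fin n) k}
    (hf0 : ∀ i, constantCoeff (f i) = 0) (hs : HasSubst f)
    (hfin : Module.Finite (substAlgHom (R := k) hs).range (MvPowerSeries (Fin n) k))
    (hfree : Module.Free (substAlgHom (R := k) hs).range (MvPowerSeries (Fin n) k))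
    (hrank : Module.finrank (substAlgHom (R := k) hs).range (MvPowerSeries (Fin n) k) = q ^ n)
    (hf : ∀ i, lowCoeff k n q (f i) = 0) {g : MvPowerSeries (Fin n) k}
    (hg : lowCoeff k n q g = 0) : g ∈ Ideal.span (Set.range f) := by
  classical
  set J := Ideal.span (Set.range f) with hJ
  let J' : Submodule k (MvPowerSeries (Fin n) k) := J.restrictScalars k
  let b := Module.finBasisOfFinrankEq (substAlgHom (R := k) hs).range _ hrank
  have hspan : Submodule.span k (Set.range fun i => J'.mkQ (b i)) = ⊤ := by
    rw [eq_top_iff]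
    rintro y -
    obtain ⟨m, rfl⟩ := J'.mkQ_surjective y
    rw [← b.sum_repr m, map_sum]
    refine Submodule.sum_mem _ fun i _ => ?_
    obtain ⟨u, hu⟩ := (b.repr m i).2
    have hmem : (b.repr m i) • b i - constantCoeff u • b i ∈ J' := by
      have h := J.mul_mem_right (b i) (subst_sub_C_mem_span hf0 u)
      have hu' : ((b.repr m i : _) : MvPowerSeries (Fin n) k) = u.subst f :=
        hu.symm.trans (substAlgHom_apply hs u)
      rw [← hu', sub_mul, ← smul_eq_C_mul] at h
      exact h
    have : J'.mkQ ((b.repr m i) • b i) = constantCoeff u • J'.mkQ (b i) := by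
      rw [← map_smul J'.mkQ, ← sub_eq_zero, ← map_sub]
      exact (Submodule.Quotient.mk_eq_zero _).2 hmem
    rw [this]
    exact Submodule.smul_mem _ _ (Submodule.subset_span ⟨i, rfl⟩)
  have hfinite : Module.Finite k (MvPowerSeries (Fin n) k ⧸ J') :=
    ⟨⟨(Finset.univ.image fun i => J'.mkQ (b i)), by simpa using hspan⟩⟩
  have hle : Module.finrank k (MvPowerSeries (Fin n) k ⧸ J') ≤ q ^ n := by
    have h := finrank_range_le_card (R := k) fun i => J'.mkQ (b i)
    rw [Set.finrank, hspan, finrank_top, Fintype.card_fin] at h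
    exact h
  -- The quotient by `(f)` has dimension at most `q ^ n` and surjects onto a space of dimension `q ^
  -- n`; the surjection is therefore injective, so `(f)` is the whole kernel of `lowCoeff`.
  let φ : (MvPowerSeries (Fin n) k ⧸ J') →ₗ[k] ((Fin n → Fin q) → k) :=
    J'.liftQ (lowCoeff k n q) fun x hx => lowCoeff_eq_zero_of_mem_span hf hx
  have hφ : Function.Surjective φ := fun v => by
    obtain ⟨m, hm⟩ := lowCoeff_surjective (k := k) (n := n) q v
    exact ⟨J'.mkQ m, hm⟩
  have hdim : Module.finrank k (MvPowerSeries (Fin n) k ⧸ J') =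
      Module.finrank k ((Fin n → Fin q) → k) := by
    refine le_antisymm (by simpa using hle) (LinearMap.finrank_le_finrank_of_surjective hφ)
  have hinj : Function.Injective φ :=
    (LinearMap.injective_iff_surjective_of_finrank_eq_finrank hdim).2 hφ
  have : J'.mkQ g = 0 := hinj (by rw [map_zero]; exact hg)
  exact (Submodule.Quotient.mk_eq_zero _).1 this

theorem coeff_mul_of_forall_lt {σ R : Type*} [CommRing R] [Fintype σ] {a f : MvPowerSeries σ R}
    {d : σ →₀ ℕ} (h : ∀ e, e ≤ d → e ≠ d → coeff e f = 0) :
    coeff d (a * f) = constantCoeff a * coeff d f := by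
  classical
  rw [coeff_mul, Finset.sum_eq_single (0, d)]
  · simp
  · rintro ⟨x, y⟩ hxy hne
    rw [Finset.HasAntidiagonal.mem_antidiagonal] at hxy
    have hy : y ≠ d := by
      rintro rfl
      simp at hxy
      exact hne (by rw [hxy])
    rw [h y (hxy ▸ le_add_self) hy, mul_zero]
  · simp

/-- Write `X_s ^ q = ∑ a_i f_i` and compare coefficients of `X_t ^ q`. Its proper divisors do not
occur in `f_i`, so only the constant terms of the `a_i` contribute; they form the inverse matrix. -/
theorem exists_mul_coeff_single_eq_one {q : ℕ} (hq : 0 < q)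
    {f : Fin n → MvPowerSeries (Fin n) k}
    (hf0 : ∀ i, constantCoeff (f i) = 0) (hs : HasSubst f)
    (hfin : Module.Finite (substAlgHom (R := k) hs).range (MvPowerSeries (Fin n) k))
    (hfree : Module.Free (substAlgHom (R := k) hs).range (MvPowerSeries (Fin n) k))
    (hrank : Module.finrank (substAlgHom (R := k) hs).range (MvPowerSeries (Fin n) k) = q ^ n)
    (hf : ∀ i, lowCoeff k n q (f i) = 0) :
    ∃ N : Matrix (Fin n) (Fin n) k,
      N * Matrix.of (fun i j => coeff (Finsupp.single j q) (f i)) = 1 := by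
  classical
  have hX : ∀ s : Fin n, (X s : MvPowerSeries (Fin n) k) ^ q ∈ Ideal.span (Set.range f) := by
    intro s
    refine mem_span_of_lowCoeff_eq_zero hf0 hs hfin hfree hrank hf ?_
    rw [lowCoeff_eq_zero_iff]
    intro d hd
    rw [coeff_X_pow, if_neg]
    rintro rfl
    simpa using hd s
  have hA : ∀ s : Fin n, ∃ a : Fin n → MvPowerSeries (Fin n) k, ∑ i, a i * f i = X s ^ q :=
    fun s => by simpa using (Submodule.mem_span_range_iff_exists_fun _).1 (hX s)
  choose a ha using hA
  refine ⟨Matrix.of fun s i => constantCoeff (a s i), ?_⟩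
  ext s t
  have h := congrArg (coeff (Finsupp.single t q)) (ha s)
  rw [map_sum, coeff_X_pow] at h
  rw [Matrix.mul_apply, Matrix.one_apply]
  simp only [Finsupp.single_left_inj hq.ne', @eq_comm _ t s] at h
  rw [← h]
  refine Finset.sum_congr rfl fun i _ => ?_
  rw [coeff_mul_of_forall_lt]
  · rfl
  · intro e he hne
    refine lowCoeff_eq_zero_iff.1 (hf i) e fun j => ?_
    rcases eq_or_ne j t with rfl | hj
    · refine lt_of_le_of_ne (by simpa using he j) fun h => hne ?_
      ext l
      rcases eq_or_ne l j with rfl | hl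
      · simpa using h
      · simpa [hl.symm] using he l
    · have := he j
      simp [hj.symm] at this
      omega

end Intersection

/-! ### Ultrametric estimates for powers and monomials. -/

section Ultrametric

theorem norm_prod_sub_prod_le {K ι : Type*} [NormedField K] [IsUltrametricDist K] {u v : ι → K}
    {δ : ℝ} (hδ : 0 ≤ δ) (s : Finset ι) (hu : ∀ i, ‖u i‖ ≤ 1) (hv : ∀ i, ‖v i‖ ≤ 1)
    (h : ∀ i, ‖u i - v i‖ ≤ δ) : ‖∏ i ∈ s, u i - ∏ i ∈ s, v i‖ ≤ δ := by
  classical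
  induction s using Finset.induction_on with
  | empty => simpa using hδ
  | insert a s ha ih =>
    rw [Finset.prod_insert ha, Finset.prod_insert ha]
    have hprod : ‖∏ i ∈ s, u i‖ ≤ 1 := by
      rw [norm_prod]
      exact Finset.prod_le_one (fun _ _ => norm_nonneg _) fun i _ => hu i
    rw [show u a * ∏ i ∈ s, u i - v a * ∏ i ∈ s, v i =
      (u a - v a) * ∏ i ∈ s, u i + v a * (∏ i ∈ s, u i - ∏ i ∈ s, v i) by ring]
    refine (IsUltrametricDist.norm_add_le_max _ _).trans (max_le ?_ ?_)
    · rw [norm_mul]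
      exact (mul_le_of_le_one_right (norm_nonneg _) hprod).trans (h a)
    · rw [norm_mul]
      exact (mul_le_of_le_one_left (norm_nonneg _) (hv a)).trans ih

theorem norm_pow_sub_pow_le {K : Type*} [NormedField K] [IsUltrametricDist K] {u v : K}
    {δ : ℝ} (hδ : 0 ≤ δ) (hu : ‖u‖ ≤ 1) (hv : ‖v‖ ≤ 1) (h : ‖u - v‖ ≤ δ) (m : ℕ) :
    ‖u ^ m - v ^ m‖ ≤ δ := by
  simpa using norm_prod_sub_prod_le hδ (Finset.range m) (u := fun _ => u) (v := fun _ => v)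
    (fun _ => hu) (fun _ => hv) (fun _ => h)

theorem norm_mul_sub_mul_le {K : Type*} [NormedField K] [IsUltrametricDist K] {a b u v : K}
    {C : ℝ} (h1 : ‖a - b‖ * ‖u‖ ≤ C) (h2 : ‖b‖ * ‖u - v‖ ≤ C) : ‖a * u - b * v‖ ≤ C := by
  rw [show a * u - b * v = (a - b) * u + b * (u - v) by ring]
  refine (IsUltrametricDist.norm_add_le_max _ _).trans (max_le ?_ ?_) <;> rwa [norm_mul]

/-- Raising to a `p`-power contracts distances, up to the factor `‖p‖`. -/
theorem norm_prime_pow_sub_prime_pow_le {K : Type*} [NormedField K] [IsUltrametricDist K] {p : ℕ}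
    (hp : p.Prime) {u v : K} {ρ δ : ℝ} (hu : ‖u‖ ≤ ρ) (hδ : δ ≤ ρ) (hρ : ρ ≤ 1)
    (h : ‖v - u‖ ≤ δ) (n : ℕ) :
    ‖v ^ p ^ n - u ^ p ^ n‖ ≤ max (‖(p : K)‖ * (ρ * δ)) (δ ^ p ^ n) := by
  have hδ0 : 0 ≤ δ := (norm_nonneg _).trans h
  have hρ0 : 0 ≤ ρ := hδ0.trans hδ
  obtain ⟨t, rfl⟩ : ∃ t, v = u + t := ⟨v - u, by ring⟩
  rw [add_sub_cancel_left] at h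
  -- The binomial expansion is `u ^ p ^ n + t ^ p ^ n` plus `p * u * t` times an integral element.
  rw [(Commute.all u t).add_pow_prime_pow_eq hp n, add_assoc, add_sub_cancel_left, add_comm]
  refine (IsUltrametricDist.norm_add_le_max _ _).trans (max_le_max ?_ ?_)
  · rw [norm_mul, norm_mul, norm_mul, mul_assoc ‖(p : K)‖]
    refine (mul_le_of_le_one_right (by positivity) ?_).trans (by gcongr)
    refine IsUltrametricDist.norm_sum_le_of_forall_le_of_nonneg zero_le_one fun k _ => ?_
    rw [norm_mul, norm_mul, norm_pow, norm_pow]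
    refine mul_le_one₀ (mul_le_one₀ (pow_le_one₀ (norm_nonneg _) (hu.trans hρ)) (by positivity)
      (pow_le_one₀ (norm_nonneg _) (h.trans (hδ.trans hρ)))) (norm_nonneg _)
      (IsUltrametricDist.norm_natCast_le_one K _)
  · rw [norm_pow]
    exact pow_le_pow_left₀ (norm_nonneg _) h _

end Ultrametric

section Monomials

variable {K σ : Type*} [NormedField K] [Fintype σ] {x y : σ → K}

theorem norm_monomial_le_pow {r : ℝ} (hx : ‖x‖ ≤ r) (d : σ →₀ ℕ) :
    ‖∏ s, x s ^ d s‖ ≤ r ^ d.degree := by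
  rw [norm_prod, Finsupp.degree_eq_sum, ← Finset.prod_pow_eq_pow_sum]
  refine Finset.prod_le_prod (fun s _ => norm_nonneg _) (fun s _ => ?_)
  rw [norm_pow]
  exact pow_le_pow_left₀ (norm_nonneg _) ((norm_le_pi_norm x s).trans hx) _

theorem norm_monomial_le_one (hx : ‖x‖ ≤ 1) (d : σ →₀ ℕ) : ‖∏ s, x s ^ d s‖ ≤ 1 := by
  simpa using norm_monomial_le_pow hx d

theorem norm_monomial_le {r : ℝ} (hr : r ≤ 1) (hx : ‖x‖ ≤ r) {d : σ →₀ ℕ} (hd : d ≠ 0) :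
    ‖∏ s, x s ^ d s‖ ≤ r :=
  (norm_monomial_le_pow hx d).trans (pow_le_of_le_one ((norm_nonneg _).trans hx) hr
    fun h => hd ((Finsupp.degree_eq_zero_iff d).1 h))

theorem monomial_single_add [DecidableEq σ] (x : σ → K) (s : σ) (m : ℕ) (d : σ →₀ ℕ) :
    ∏ t, x t ^ (Finsupp.single s m + d) t = x s ^ m * ∏ t, x t ^ d t := by
  simp only [Finsupp.add_apply, pow_add, Finset.prod_mul_distrib]
  congr 1
  rw [Finset.prod_eq_single s]
  · simp
  · intro t _ ht
    simp [ht.symm]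
  · simp

theorem norm_monomial_sub_le [IsUltrametricDist K] (hx : ‖x‖ ≤ 1) (hy : ‖y‖ ≤ 1) (d : σ →₀ ℕ) :
    ‖∏ s, y s ^ d s - ∏ s, x s ^ d s‖ ≤ ‖y - x‖ := by
  have hx' := fun s => (norm_le_pi_norm x s).trans hx
  have hy' := fun s => (norm_le_pi_norm y s).trans hy
  refine norm_prod_sub_prod_le (norm_nonneg _) _ (fun s => ?_) (fun s => ?_) fun s =>
    norm_pow_sub_pow_le (norm_nonneg _) (hy' s) (hx' s) (norm_le_pi_norm (y - x) s) _
  · rw [norm_pow]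
    exact pow_le_one₀ (norm_nonneg _) (hy' s)
  · rw [norm_pow]
    exact pow_le_one₀ (norm_nonneg _) (hx' s)

end Monomials

/-- A tuple of power series over `ℤ_[p]` with linear part `p Z` which is congruent modulo `p` to a
tuple of series in the ideal `(Z_j ^ q)`, with invertible matrix of coefficients of the
monomials `Z_j ^ q`. -/
structure IsFrobeniusLike {p : ℕ} [Fact p.Prime] {σ : Type*} [Fintype σ] [DecidableEq σ] (q : ℕ)
    (f : σ → MvPowerSeries σ ℤ_[p]) : Prop where
  constantCoeff_eq_zero : ∀ i, constantCoeff (f i) = 0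
  coeff_single_one : ∀ i j, coeff (Finsupp.single j 1) (f i) = if i = j then (p : ℤ_[p]) else 0
  norm_coeff_le : ∀ i (d : σ →₀ ℕ), (∀ j, d j < q) → ‖coeff d (f i)‖ ≤ (p : ℝ)⁻¹
  exists_matrix : ∃ N : Matrix σ σ ℤ_[p], ∀ i j,
    ‖(N * Matrix.of (fun i j => coeff (Finsupp.single j q) (f i)) - 1) i j‖ ≤ (p : ℝ)⁻¹

theorem PadicAlgCl.norm_natCast_prime (p : ℕ) [Fact p.Prime] :
    ‖(p : PadicAlgCl p)‖ = (p : ℝ)⁻¹ := by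
  rw [← map_natCast (algebraMap ℚ_[p] (PadicAlgCl p)), PadicAlgCl.norm_extends, Padic.norm_p]

theorem padicEval_sum_C_mul_X_pow {p : ℕ} [Fact p.Prime] {σ : Type*} [Fintype σ] (c : σ → ℤ_[p])
    (q : ℕ) {x : σ → PadicAlgCl p} (hx : ∀ s, ‖x s‖ < 1) :
    padicEval (∑ j, C (c j) * X j ^ q : MvPowerSeries σ ℤ_[p]) x =
      ∑ j, padicIntToAlgCl p (c j) * x j ^ q := by
  change padicEvalHom x hx _ = _
  have hC : ∀ a, padicEvalHom x hx (C a) = padicIntToAlgCl p a := fun a => padicEval_C a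
  have hX : ∀ j, padicEvalHom x hx (X j) = x j := fun j => padicEval_X j
  simp only [map_sum, map_mul, map_pow, hC, hX]

theorem norm_padicEval_sub_padicEval_le {p : ℕ} [Fact p.Prime] {σ : Type*} [Fintype σ]
    {x y : σ → PadicAlgCl p} {g : MvPowerSeries σ ℤ_[p]} {C : ℝ} (hC : 0 ≤ C)
    (hx : ∀ s, ‖x s‖ < 1) (hy : ∀ s, ‖y s‖ < 1)
    (h : ∀ d : σ →₀ ℕ, ‖coeff d g‖ * ‖∏ s, y s ^ d s - ∏ s, x s ^ d s‖ ≤ C) :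
    ‖padicEval g y - padicEval g x‖ ≤ C := by
  rw [padicEval_def, padicEval_def, ← (summable_padicIntToAlgCl g hy).tsum_sub
    (summable_padicIntToAlgCl g hx)]
  refine IsUltrametricDist.norm_tsum_le_of_forall_le_of_nonneg hC fun d => ?_
  rw [← mul_sub, norm_mul, norm_padicIntToAlgCl]
  exact h d

/-! ### Size and separation of the zeros. -/

namespace IsFrobeniusLike

variable {p : ℕ} [Fact p.Prime] {σ : Type*} [Fintype σ] [DecidableEq σ] {q : ℕ}
  {f : σ → MvPowerSeries σ ℤ_[p]} {x y : σ → PadicAlgCl p}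

/-- For a larger zero the terms in `x_j ^ q` would dominate: all others have norm at most `C < r ^
q`, where `r = ‖x‖`. Inverting the matrix modulo `p` then makes every coordinate smaller than `r`,
contradicting that the sup norm is attained. -/
theorem norm_pow_le_of_padicEval_eq_zero (hf : IsFrobeniusLike q f) (hq : 2 ≤ q)
    (hx : ∀ s, ‖x s‖ < 1) (h0 : ∀ i, padicEval (f i) x = 0) : ‖x‖ ^ (q - 1) ≤ (p : ℝ)⁻¹ := by
  by_contra! hlt
  set a : ℝ := (p : ℝ)⁻¹ with ha
  have ha0 : 0 < a := inv_pos.2 (Nat.cast_pos.2 (Fact.out : p.Prime).pos)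
  set r : ℝ := ‖x‖ with hr
  have hr1 : r < 1 := (pi_norm_lt_iff one_pos).2 hx
  have hr0 : 0 < r := by
    rcases (norm_nonneg x).eq_or_lt with h | h
    · rw [hr, ← h, zero_pow (by omega)] at hlt
      exact absurd hlt ha0.le.not_gt
    · exact h
  have hrq : r ^ q = r ^ (q - 1) * r := by rw [← pow_succ, Nat.sub_add_cancel (by omega)]
  -- The first entry bounds proper multiples of some `X_j ^ q`; the second bounds terms whose
  -- coefficient is divisible by `p`, as well as the error in inverting the matrix.
  set C : ℝ := max (r ^ (q + 1)) (a * r) with hC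
  have hCr : C < r ^ q := by
    refine max_lt (pow_lt_pow_right_of_lt_one₀ hr0 hr1 (Nat.lt_succ_self q)) ?_
    rw [hrq]
    exact mul_lt_mul_of_pos_right hlt hr0
  have hC0 : 0 ≤ C := le_max_of_le_left (by positivity)
  obtain ⟨N, hN⟩ := hf.exists_matrix
  set M : Matrix σ σ ℤ_[p] := Matrix.of fun i j => coeff (Finsupp.single j q) (f i) with hM
  have hmain : ∀ i, ‖∑ j, padicIntToAlgCl p (M i j) * x j ^ q‖ ≤ C := by
    intro i
    rw [← padicEval_sum_C_mul_X_pow _ _ hx, ← norm_neg, ← zero_sub, ← h0 i, ← padicEval_sub _ _ hx]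
    refine norm_padicEval_le hC0 fun d => ?_
    rw [norm_mul, norm_padicIntToAlgCl, map_sub, map_sum]
    simp only [coeff_C_mul, coeff_X_pow]
    by_cases hd : ∃ j, d = Finsupp.single j q
    · obtain ⟨j, rfl⟩ := hd
      have hq0 : q ≠ 0 := by omega
      simp only [Finsupp.single_left_inj hq0]
      simpa [hM] using hC0
    · rw [Finset.sum_eq_zero fun j _ => by rw [if_neg fun h => hd ⟨j, h⟩, mul_zero], sub_zero]
      by_cases hlow : ∀ j, d j < q
      · by_cases hd0 : d = 0
        · rw [hd0, coeff_zero_eq_constantCoeff_apply, hf.constantCoeff_eq_zero]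
          simpa using hC0
        · refine le_max_of_le_right (mul_le_mul (hf.norm_coeff_le i d hlow)
            (norm_monomial_le hr1.le le_rfl hd0) (norm_nonneg _) ha0.le)
      · push Not at hlow
        obtain ⟨j, hj⟩ := hlow
        refine le_max_of_le_left ((mul_le_of_le_one_left (norm_nonneg _)
          (PadicInt.norm_le_one _)).trans ((norm_monomial_le_pow le_rfl d).trans
            (pow_le_pow_of_le_one hr0.le hr1.le ?_)))
        obtain ⟨e, rfl⟩ : ∃ e, d = Finsupp.single j q + e :=
          ⟨d - Finsupp.single j q, (add_tsub_cancel_of_le (by simpa using hj)).symm⟩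
        have he : e ≠ 0 := by
          rintro rfl
          exact hd ⟨j, by simp⟩
        have hdeg : e.degree ≠ 0 := fun h => he ((Finsupp.degree_eq_zero_iff e).1 h)
        rw [map_add, Finsupp.degree_single]
        omega
  have hcoord : ∀ s, ‖x s‖ < r := by
    intro s
    refine lt_of_pow_lt_pow_left₀ q hr0.le (lt_of_le_of_lt ?_ hCr)
    have hid : x s ^ q = ∑ i, padicIntToAlgCl p (N s i) *
        (∑ j, padicIntToAlgCl p (M i j) * x j ^ q) -
        ∑ j, padicIntToAlgCl p ((N * M - 1) s j) * x j ^ q := by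
      have h1 : ∑ i, padicIntToAlgCl p (N s i) * (∑ j, padicIntToAlgCl p (M i j) * x j ^ q) =
          ∑ j, padicIntToAlgCl p ((N * M) s j) * x j ^ q := by
        simp only [Finset.mul_sum, Matrix.mul_apply, map_sum, map_mul, Finset.sum_mul, mul_assoc]
        exact Finset.sum_comm
      rw [h1, ← Finset.sum_sub_distrib]
      simp only [Matrix.sub_apply, map_sub, sub_mul, sub_sub_cancel, Matrix.one_apply]
      simp
    rw [← norm_pow, hid, sub_eq_add_neg]
    refine (IsUltrametricDist.norm_add_le_max _ _).trans (max_le ?_ ((norm_neg _).trans_le ?_))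
    · refine IsUltrametricDist.norm_sum_le_of_forall_le_of_nonneg hC0 fun i _ => ?_
      rw [norm_mul, norm_padicIntToAlgCl]
      exact (mul_le_of_le_one_left (norm_nonneg _) (PadicInt.norm_le_one _)).trans (hmain i)
    · refine IsUltrametricDist.norm_sum_le_of_forall_le_of_nonneg hC0 fun j _ => ?_
      rw [norm_mul, norm_padicIntToAlgCl, norm_pow]
      refine le_max_of_le_right (mul_le_mul (hN s j) ?_ (by positivity) ha0.le)
      exact (pow_le_of_le_one (norm_nonneg _) (hx j).le (by omega)).trans (norm_le_pi_norm x j)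
  exact lt_irrefl r ((pi_norm_lt_iff hr0).2 hcoord)

/-- Subtracting `f(x) = 0` from `f(y) = 0` expresses `p (y - x)` through differences of the
nonlinear terms. If `δ = ‖y - x‖` were positive, these would all be smaller than `‖p‖ δ`. -/
theorem eq_of_norm_sub_lt {r : ℕ} (hf : IsFrobeniusLike (p ^ r) f) (hr : r ≠ 0) {ρ : ℝ}
    (hρ0 : 0 < ρ) (hρ : ρ ^ (p ^ r - 1) = (p : ℝ)⁻¹) (hx : ‖x‖ ≤ ρ) (hy : ‖y‖ ≤ ρ)
    (hx0 : ∀ i, padicEval (f i) x = 0) (hy0 : ∀ i, padicEval (f i) y = 0)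
    (hxy : ‖y - x‖ < ρ) : y = x := by
  have hp : p.Prime := Fact.out
  have hq : 2 ≤ p ^ r := hp.two_le.trans (Nat.le_self_pow hr p)
  set q := p ^ r with hqdef
  set a : ℝ := (p : ℝ)⁻¹ with ha
  have ha0 : 0 < a := inv_pos.2 (Nat.cast_pos.2 hp.pos)
  have ha1 : a < 1 := inv_lt_one_of_one_lt₀ (Nat.one_lt_cast.2 hp.one_lt)
  have hρ1 : ρ < 1 := by
    by_contra! h
    exact (hρ ▸ one_le_pow₀ h).not_gt ha1
  have hρq : ρ ^ q = a * ρ := by rw [← hρ, ← pow_succ, Nat.sub_add_cancel (by omega)]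
  have hx1 : ∀ s, ‖x s‖ < 1 := fun s => ((norm_le_pi_norm x s).trans hx).trans_lt hρ1
  have hy1 : ∀ s, ‖y s‖ < 1 := fun s => ((norm_le_pi_norm y s).trans hy).trans_lt hρ1
  set δ : ℝ := ‖y - x‖ with hδ
  by_contra hne
  have hδ0 : 0 < δ := norm_pos_iff.2 (sub_ne_zero.2 hne)
  set C : ℝ := max (a * (ρ * δ)) (δ ^ q) with hC
  have hCδ : C < a * δ := by
    refine max_lt (mul_lt_mul_of_pos_left (mul_lt_of_lt_one_left hδ0 hρ1) ha0) ?_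
    calc δ ^ q = δ ^ (q - 1) * δ := by rw [← pow_succ, Nat.sub_add_cancel (by omega)]
      _ < ρ ^ (q - 1) * δ :=
        mul_lt_mul_of_pos_right (pow_lt_pow_left₀ hxy hδ0.le (by omega)) hδ0
      _ = a * δ := by rw [hρ]
  have hC0 : 0 ≤ C := le_max_of_le_left (by positivity)
  have hcoord : ∀ i, ‖(y - x) i‖ < δ := by
    intro i
    have heval : ∀ z : σ → PadicAlgCl p, (∀ s, ‖z s‖ < 1) → padicEval (f i) z = 0 →
        padicEval (f i - MvPowerSeries.C (p : ℤ_[p]) * X i) z = -(p * z i) := by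
      intro z hz hz0
      rw [padicEval_sub _ _ hz, padicEval_mul _ _ hz, hz0, padicEval_C, padicEval_X, zero_sub,
        map_natCast]
    have hle : ‖padicEval (f i - MvPowerSeries.C (p : ℤ_[p]) * X i) y -
        padicEval (f i - MvPowerSeries.C (p : ℤ_[p]) * X i) x‖ ≤ C := by
      refine norm_padicEval_sub_padicEval_le hC0 hx1 hy1 fun d => ?_
      rw [map_sub, coeff_C_mul, coeff_X]
      by_cases hd1 : ∃ j, d = Finsupp.single j 1
      · obtain ⟨j, rfl⟩ := hd1
        simp only [Finsupp.single_left_inj one_ne_zero, hf.coeff_single_one, @eq_comm _ j i]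
        simpa using hC0
      rw [if_neg fun h => hd1 ⟨i, h⟩, mul_zero, sub_zero]
      by_cases hd0 : d = 0
      · simpa [hd0] using hC0
      -- Low monomials have coefficient divisible by `p` and degree at least two, which gains a
      -- factor `ρ`. The others contain some `X_j ^ q`, whose variation is controlled by
      -- `norm_prime_pow_sub_prime_pow_le`; varying the cofactor costs at most `ρ ^ q * δ = a * ρ *
      -- δ`.
      by_cases hlow : ∀ j, d j < q
      · obtain ⟨j, hj⟩ := Finsupp.ne_iff.1 hd0
        obtain ⟨e, rfl⟩ : ∃ e, d = Finsupp.single j 1 + e :=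
          ⟨d - Finsupp.single j 1, (add_tsub_cancel_of_le
            (by simpa using Nat.one_le_iff_ne_zero.2 hj)).symm⟩
        have he : e ≠ 0 := by
          rintro rfl
          exact hd1 ⟨j, by simp⟩
        refine le_max_of_le_left (mul_le_mul (hf.norm_coeff_le i _ hlow) ?_ (norm_nonneg _)
          ha0.le)
        rw [monomial_single_add, monomial_single_add, pow_one, pow_one]
        refine norm_mul_sub_mul_le ?_ ?_
        · rw [mul_comm]
          exact mul_le_mul (norm_monomial_le hρ1.le hy he) (norm_le_pi_norm (y - x) j)
            (norm_nonneg _) hρ0.le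
        · exact mul_le_mul ((norm_le_pi_norm x j).trans hx)
            (norm_monomial_sub_le (hx.trans hρ1.le) (hy.trans hρ1.le) e) (norm_nonneg _) hρ0.le
      · push Not at hlow
        obtain ⟨j, hj⟩ := hlow
        obtain ⟨e, rfl⟩ : ∃ e, d = Finsupp.single j q + e :=
          ⟨d - Finsupp.single j q, (add_tsub_cancel_of_le (by simpa using hj)).symm⟩
        refine (mul_le_of_le_one_left (norm_nonneg _) (PadicInt.norm_le_one _)).trans ?_
        rw [monomial_single_add, monomial_single_add]
        refine norm_mul_sub_mul_le ?_ ?_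
        · refine (mul_le_of_le_one_right (norm_nonneg _)
            (norm_monomial_le_one (hy.trans hρ1.le) e)).trans ?_
          rw [hC, ha, ← PadicAlgCl.norm_natCast_prime]
          exact norm_prime_pow_sub_prime_pow_le hp ((norm_le_pi_norm x j).trans hx) hxy.le hρ1.le
            (norm_le_pi_norm (y - x) j) r
        · refine le_max_of_le_left ?_
          rw [← mul_assoc, ← hρq, norm_pow]
          exact mul_le_mul
            (pow_le_pow_left₀ (norm_nonneg _) ((norm_le_pi_norm x j).trans hx) _)
            (norm_monomial_sub_le (hx.trans hρ1.le) (hy.trans hρ1.le) e) (norm_nonneg _)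
            (by positivity)
    rw [heval y hy1 (hy0 i), heval x hx1 (hx0 i),
      show -(p * y i) - -(p * x i) = -((p : PadicAlgCl p) * (y - x) i) by
        rw [Pi.sub_apply]; ring, norm_neg, norm_mul, PadicAlgCl.norm_natCast_prime] at hle
    exact lt_of_mul_lt_mul_left (hle.trans_lt hCδ) ha0.le
  exact lt_irrefl δ ((pi_norm_lt_iff hδ0).2 hcoord)

end IsFrobeniusLike

/-! ### Action of inertia and wild inertia. -/

section WildInertia

variable {p : ℕ} [Fact p.Prime]

theorem norm_sub_lt_one_of_mem_padicInertia {g : Gal(PadicAlgCl p/ℚ_[p])}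
    (hg : g ∈ padicInertia p) {x : PadicAlgCl p} (hx : ‖x‖ ≤ 1) : ‖g x - x‖ < 1 := by
  let A := (PadicAlgCl.valued p).v.valuationSubring
  obtain ⟨h, hh, rfl⟩ : ∃ h ∈ A.inertiaSubgroup ℚ_[p], h.1 = g := hg
  have hmem : ∀ z : PadicAlgCl p, z ∈ A ↔ ‖z‖ ≤ 1 := fun z => by
    rw [Valuation.mem_valuationSubring_iff, ← NNReal.coe_le_coe, PadicAlgCl.valuation_coe,
      NNReal.coe_one]
  let a : A := ⟨x, (hmem x).2 hx⟩
  have h1 : MulSemiringAction.toRingAut (A.decompositionSubgroup ℚ_[p])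
      (IsLocalRing.ResidueField A) h = 1 := hh
  have h2 : h • IsLocalRing.residue A a = IsLocalRing.residue A a :=
    DFunLike.congr_fun h1 (IsLocalRing.residue A a)
  rw [← IsLocalRing.ResidueField.residue_smul, ← sub_eq_zero, ← map_sub,
    IsLocalRing.residue_eq_zero_iff, IsLocalRing.mem_maximalIdeal, mem_nonunits_iff] at h2
  -- An element of the valuation ring with norm at least one is a unit, hence cannot have residue
  -- zero.
  by_contra! hle
  refine h2 ?_
  set b : A := h • a - a with hb
  have hb' : (b : PadicAlgCl p) = h.1 x - x := rfl
  have hne : (b : PadicAlgCl p) ≠ 0 := by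
    rw [hb', ← norm_pos_iff]
    exact one_pos.trans_le hle
  refine isUnit_iff_exists_inv.2 ⟨⟨(b : PadicAlgCl p)⁻¹, (hmem _).2 ?_⟩, ?_⟩
  · rw [norm_inv]
    exact inv_le_one_of_one_le₀ hle
  · exact Subtype.ext (mul_inv_cancel₀ hne)

theorem PadicAlgCl.norm_natCast_eq_one {m : ℕ} (hm : p.Coprime m) :
    ‖(m : PadicAlgCl p)‖ = 1 := by
  rw [← map_natCast (algebraMap ℚ_[p] (PadicAlgCl p)), PadicAlgCl.norm_extends,
    Padic.norm_natCast_eq_one_iff]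
  exact hm

/-- If `η ≠ 1`, then `1 + η + ⋯ + η ^ (m - 1) = 0`; but this sum is close to `m`, a unit. -/
theorem eq_one_of_pow_eq_one_of_norm_sub_one_lt {m : ℕ} (hm : p.Coprime m) {η : PadicAlgCl p}
    (h1 : η ^ m = 1) (hη : ‖η - 1‖ < 1) : η = 1 := by
  by_contra hne
  have hsum : ∑ i ∈ Finset.range m, η ^ i = 0 := by
    have h := geom_sum_mul η m
    rw [h1, sub_self] at h
    exact (mul_eq_zero.1 h).resolve_right (sub_ne_zero.2 hne)
  have hη1 : ‖η‖ ≤ 1 := by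
    have h := IsUltrametricDist.norm_add_le_max (η - 1) 1
    rw [sub_add_cancel, norm_one] at h
    exact h.trans (max_le hη.le le_rfl)
  have hle : ‖(m : PadicAlgCl p)‖ ≤ ‖η - 1‖ := by
    have h : (m : PadicAlgCl p) = -∑ i ∈ Finset.range m, (η ^ i - 1 ^ i) := by
      simp [Finset.sum_sub_distrib, hsum]
    rw [h, norm_neg]
    exact IsUltrametricDist.norm_sum_le_of_forall_le_of_nonneg (norm_nonneg _) fun i _ =>
      norm_pow_sub_pow_le (norm_nonneg _) hη1 norm_one.le le_rfl i
  rw [PadicAlgCl.norm_natCast_eq_one hm] at hle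
  exact hle.not_gt hη

/-- Roots of unity of order prime to `p` are fixed by inertia. -/
theorem padicInertia_apply_eq_of_pow_eq_one {m : ℕ} (hm0 : m ≠ 0) (hm : p.Coprime m)
    {g : Gal(PadicAlgCl p/ℚ_[p])} (hg : g ∈ padicInertia p) {ζ : PadicAlgCl p}
    (hζ : ζ ^ m = 1) : g ζ = ζ := by
  have hnorm : ‖ζ‖ = 1 := (pow_eq_one_iff_of_nonneg (norm_nonneg ζ) hm0).1 (by
    rw [← norm_pow, hζ, norm_one])
  have hζ0 : ζ ≠ 0 := norm_pos_iff.1 (hnorm ▸ one_pos)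
  have h := eq_one_of_pow_eq_one_of_norm_sub_one_lt hm (η := g ζ / ζ)
    (by rw [div_pow, ← map_pow, hζ, map_one, div_one])
    (by
      rw [div_sub_one hζ0, norm_div, hnorm, div_one]
      exact norm_sub_lt_one_of_mem_padicInertia hg hnorm.le)
  exact (div_eq_one_iff_eq hζ0).1 h

/-- A pro-`p` subgroup of inertia fixes the `m`-th roots of elements of `ℚ_[p]` for `m` prime
to `p`. -/
theorem apply_eq_of_mem_isProPSubgroup {H : Subgroup Gal(PadicAlgCl p/ℚ_[p])}
    (hI : H ≤ padicInertia p) (hH : IsProPSubgroup p H) {m : ℕ} (hm0 : m ≠ 0) (hm : p.Coprime m)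
    {g : Gal(PadicAlgCl p/ℚ_[p])} (hg : g ∈ H) {π : PadicAlgCl p} {c : ℚ_[p]}
    (hπ : π ^ m = algebraMap ℚ_[p] (PadicAlgCl p) c) : g π = π := by
  rcases eq_or_ne π 0 with rfl | hπ0
  · exact map_zero g
  have hfd : FiniteDimensional ℚ_[p] (IntermediateField.adjoin ℚ_[p] {π}) :=
    IntermediateField.adjoin.finiteDimensional (Algebra.IsIntegral.isIntegral π)
  let E : IntermediateField ℚ_[p] (PadicAlgCl p) :=
    IntermediateField.normalClosure ℚ_[p] (IntermediateField.adjoin ℚ_[p] {π}) (PadicAlgCl p)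
  have hnormal : Normal ℚ_[p] E := inferInstance
  have hgal : IsGalois ℚ_[p] E := ⟨⟩
  have hπE : π ∈ E := IntermediateField.le_normalClosure _
    (IntermediateField.subset_adjoin ℚ_[p] {π} rfl)
  -- On the normal closure of `ℚ_p(π)` the element `g` has `p`-power order. Since `g π = ζ π` with
  -- `ζ ^ m = 1` and `g ζ = ζ`, iteration gives `ζ ^ p ^ k = 1`, which forces `ζ = 1`.
  obtain ⟨k, hk⟩ := hH E ⟨AlgEquiv.restrictNormalHom E g, g, hg, rfl⟩
  have hk' : AlgEquiv.restrictNormalHom E (g ^ p ^ k) = 1 := by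
    rw [map_pow]
    exact congrArg Subtype.val hk
  have hfix : (g ^ p ^ k) π = π := by
    have h := AlgEquiv.restrictNormal_commutes (g ^ p ^ k) E ⟨π, hπE⟩
    have h1 : (g ^ p ^ k).restrictNormal E = 1 := hk'
    rw [h1] at h
    exact h.symm
  set ζ : PadicAlgCl p := g π / π with hζdef
  have hgπ : g π = ζ * π := (div_mul_cancel₀ _ hπ0).symm
  have hζ : ζ ^ m = 1 := by
    rw [hζdef, div_pow, ← map_pow, hπ, AlgEquiv.commutes, div_self]
    rw [← hπ]
    exact pow_ne_zero _ hπ0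
  have hgζ : g ζ = ζ := padicInertia_apply_eq_of_pow_eq_one hm0 hm (hI hg) hζ
  have hiter : ∀ j : ℕ, (g ^ j) π = ζ ^ j * π := by
    intro j
    induction j with
    | zero => simp
    | succ j ih => rw [pow_succ', AlgEquiv.mul_apply, ih, map_mul, map_pow, hgζ, hgπ]; ring
  have hζ1 : ζ ^ p ^ k = 1 := by
    have h := hiter (p ^ k)
    rw [hfix] at h
    exact mul_right_cancel₀ hπ0 (by rw [← h, one_mul])
  have hgcd := pow_gcd_eq_one.2 ⟨hζ1, hζ⟩
  rw [(hm.pow_left k).gcd_eq_one, pow_one] at hgcd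
  rw [hgπ, hgcd, one_mul]

/-- Inertia intersected with the stabilizer of `π` is a subgroup containing every pro-`p` subgroup
of inertia, hence their supremum; whether that supremum is itself pro-`p` does not matter. -/
theorem mem_padicInertia_and_apply_eq_of_mem_padicWildInertia {g : Gal(PadicAlgCl p/ℚ_[p])}
    (hg : g ∈ padicWildInertia p) {m : ℕ} (hm0 : m ≠ 0) (hm : p.Coprime m) {π : PadicAlgCl p}
    {c : ℚ_[p]} (hπ : π ^ m = algebraMap ℚ_[p] (PadicAlgCl p) c) :
    g ∈ padicInertia p ∧ g π = π := by
  have hle : padicWildInertia p ≤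
      padicInertia p ⊓ MulAction.stabilizer Gal(PadicAlgCl p/ℚ_[p]) π :=
    sSup_le fun H hH => le_inf hH.1 fun h hh =>
      apply_eq_of_mem_isProPSubgroup hH.1 hH.2 hm0 hm hh hπ
  exact hle hg

/-- Wild inertia fixes the zeros of positive valuation of a Frobenius-like tuple of series. -/
theorem IsFrobeniusLike.padicWildInertia_apply_eq {σ : Type*} [Fintype σ] [DecidableEq σ] {r : ℕ}
    {f : σ → MvPowerSeries σ ℤ_[p]} (hf : IsFrobeniusLike (p ^ r) f) (hr : r ≠ 0)
    {x : σ → PadicAlgCl p} (hx : ∀ s, ‖x s‖ < 1) (h0 : ∀ i, padicEval (f i) x = 0)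
    {g : Gal(PadicAlgCl p/ℚ_[p])} (hg : g ∈ padicWildInertia p) (s : σ) : g (x s) = x s := by
  have hp : p.Prime := Fact.out
  have hq : 2 ≤ p ^ r := hp.two_le.trans (Nat.le_self_pow hr p)
  have hm0 : p ^ r - 1 ≠ 0 := by omega
  have hm : p.Coprime (p ^ r - 1) := by
    refine (Nat.coprime_pow_left_iff (Nat.pos_of_ne_zero hr) _ _).1 ?_
    exact (Nat.coprime_self_sub_right (by omega)).2 (Nat.coprime_one_right _)
  obtain ⟨π, hπ⟩ := IsAlgClosed.exists_pow_nat_eq (p : PadicAlgCl p) (Nat.pos_of_ne_zero hm0)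
  have hρ : ‖π‖ ^ (p ^ r - 1) = (p : ℝ)⁻¹ := by
    rw [← norm_pow, hπ, PadicAlgCl.norm_natCast_prime]
  have hp0 : (0 : ℝ) < (p : ℝ)⁻¹ := inv_pos.2 (Nat.cast_pos.2 hp.pos)
  have hπ0 : 0 < ‖π‖ := by
    refine (norm_nonneg π).lt_of_ne fun h => ?_
    rw [← h, zero_pow hm0] at hρ
    exact hp0.ne hρ
  obtain ⟨hgI, hgπ⟩ := mem_padicInertia_and_apply_eq_of_mem_padicWildInertia hg hm0 hm
    (c := p) (by rw [hπ, map_natCast])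
  have hxρ : ‖x‖ ≤ ‖π‖ := by
    refine le_of_pow_le_pow_left₀ hm0 hπ0.le ?_
    rw [hρ]
    exact hf.norm_pow_le_of_padicEval_eq_zero hq hx h0
  have hx' : ∀ t, ‖x t‖ ≤ ‖π‖ := fun t => (norm_le_pi_norm x t).trans hxρ
  refine congrFun (hf.eq_of_norm_sub_lt hr hπ0 hρ hxρ (y := fun t => g (x t)) ?_ h0 ?_ ?_) s
  · exact (pi_norm_le_iff_of_nonneg hπ0.le).2 fun t => (norm_galois g _).trans_le (hx' t)
  · intro i
    rw [← galois_padicEval g _ hx, h0, map_zero]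
  · refine (pi_norm_lt_iff hπ0).2 fun t => ?_
    -- Since `g` fixes `π` and the residue of the integral element `x t / π`, rescaling by `π`
    -- yields the strict bound on the distance.
    have hu : ‖x t / π‖ ≤ 1 := by
      rw [norm_div]
      exact div_le_one_of_le₀ (hx' t) hπ0.le
    have h := norm_sub_lt_one_of_mem_padicInertia hgI hu
    rwa [map_div₀, hgπ, ← sub_div, norm_div, div_lt_one hπ0] at h

end WildInertia

/-! ### From height and exponent to the Frobenius-like form. -/

namespace FormalGroupLaw

variable {p : ℕ} [Fact p.Prime] {n : ℕ}

theorem _root_.PadicInt.norm_le_inv_of_toZMod_eq_zero {c : ℤ_[p]} (hc : PadicInt.toZMod c = 0) :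
    ‖c‖ ≤ (p : ℝ)⁻¹ := by
  rw [← RingHom.mem_ker, PadicInt.ker_toZMod, PadicInt.maximalIdeal_eq_span_p] at hc
  have h := (PadicInt.norm_le_pow_iff_mem_span_pow c 1).2 (by simpa using hc)
  simpa using h

theorem isFrobeniusLike_mulSeries (F : FormalGroupLaw n ℤ_[p]) {r : ℕ}
    (hheight : F.reduction.HasHeight p (r * n))
    (hexp : HasExponent p (F.reduction.mulSeries p) r) :
    IsFrobeniusLike (p ^ r) (F.mulSeries p) := by
  have hp : p.Prime := Fact.out
  have hred : ∀ i, F.reduction.mulSeries p i =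
      MvPowerSeries.map PadicInt.toZMod (F.mulSeries p i) := F.map_mulSeries _ p
  have hlow : ∀ i, lowCoeff (ZMod p) n (p ^ r) (F.reduction.mulSeries p i) = 0 := by
    intro i
    rw [lowCoeff_eq_zero_iff]
    intro d hd
    by_contra hne
    by_cases hd0 : d = 0
    · rw [hd0, coeff_zero_eq_constantCoeff_apply, constantCoeff_mulSeries] at hne
      exact hne rfl
    · obtain ⟨j, hj⟩ := Finsupp.ne_iff.1 hd0
      -- Any positive exponent that occurs is at least `p ^ r`, by minimality.
      exact (hexp.2 ⟨Nat.pos_of_ne_zero hj, i, j, d, hne, rfl⟩).not_gt (hd j)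
  refine ⟨F.constantCoeff_mulSeries p, fun i j => F.coeff_single_mulSeries i j p,
    fun i d hd => ?_, ?_⟩
  · refine PadicInt.norm_le_inv_of_toZMod_eq_zero ?_
    rw [← coeff_map, ← hred]
    exact lowCoeff_eq_zero_iff.1 (hlow i) d hd
  · obtain ⟨hfin, hfree, hrank⟩ := hheight
    -- With `q = p ^ r` the rank `p ^ (r * n)` is `q ^ n`, exactly the number of low monomials.
    rw [pow_mul] at hrank
    obtain ⟨N, hN⟩ := exists_mul_coeff_single_eq_one (pow_pos hp.pos r)
      (F.reduction.constantCoeff_mulSeries p) (F.reduction.hasSubst_mulSeries p) hfin hfree hrank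
      hlow
    have hsurj : ∀ c : ZMod p, ∃ a : ℤ_[p], PadicInt.toZMod a = c := ZMod.ringHom_surjective _
    choose lift hlift using hsurj
    refine ⟨N.map lift, fun i j => PadicInt.norm_le_inv_of_toZMod_eq_zero ?_⟩
    have h := congrFun (congrFun hN i) j
    rw [Matrix.sub_apply, map_sub, sub_eq_zero]
    simp only [Matrix.mul_apply, Matrix.of_apply, Matrix.map_apply, map_sum, map_mul, hlift,
      ← coeff_map, ← hred, Matrix.one_apply] at h ⊢
    rw [h]
    split_ifs <;> simp

end FormalGroupLaw

end

theorem mainTheorem6 (ℓ : ℕ) [Fact ℓ.Prime] (hℓ : 2 < ℓ)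
    (F : FormalGroupLaw 2 ℤ_[ℓ]) (hsymm : F.IsSymmetric)
    (hheight : F.reduction.HasHeight ℓ 4)
    (hexp : FormalGroupLaw.HasExponent ℓ (F.reduction.mulSeries ℓ) 2) :
    ∀ σ ∈ padicWildInertia ℓ, ∀ P ∈ F.torsionPoints ℓ, ∀ i : Fin 2, σ (P i).1 = (P i).1 :=
  fun _ hσ P hP i =>
    -- The height `4` is read as `r * n` with `r = n = 2`.
    (F.isFrobeniusLike_mulSeries hheight hexp).padicWildInertia_apply_eq two_ne_zero
      (x := fun j => (P j).1) (fun j => (P j).2)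
      (FormalGroupLaw.padicEval_mulSeries_eq_zero hP) hσ i
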